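/- For an integer $k\ge 2$ let $G_k$ be the simple undirected graph with the following vertices: one vertex for each of the labels $0,1,2,3$; $k$ vertices labeled $4$; $(k-1)(k-2)$ vertices labeled $5$; and $k$ vertices labeled $6$. Its edges are those of the path $0 - 3 - 2 - 1$, together with the following: vertex $0$ and the $k$ vertices labeled $4$ form a $(k+1)$-clique; vertex $2$ and the $k$ vertices labeled $6$ form a $(k+1)$-clique; and each vertex labeled $5$ is a leaf attached to vertex $1$. Let $G'_k$ be the graph obtained from $G_k$ by adding the edge between $0$ and $1$, and let $\rho_k$ and $\rho'_k$ be the spectral radii of (the adjacency matrices of) $G_k$ and $G'_k$. For a finite graph $G$ with adjacency matrix $A$ and spectral radius $\rho(G)$, and for $0\le\alpha<1/\rho(G)$, Katz's index is the vector of scores $c_G=\mathbf 1\sum_{i\ge 0}\alpha^iA^i=\mathbf 1(1-\alpha A)^{-1}$, where $\mathbf 1$ is the row vector of ones. A centrality $c$ is rank monotone on $G$ if for all distinct non-adjacent vertices $x,y$ and every vertex $z\ne x,y$, writing $G'$ for $G$ with the edge $xy$ added, one has, for each $w\in\{x,y\}$, \[ c_G(z)<c_G(w)\Rightarrow c_{G'}(z)<c_{G'}(w)\qquad\text{and}\qquad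 c_G(z)\le c_G(w)\Rightarrow c_{G'}(z)\le c_{G'}(w). \] A failure of one of these implications for the endpoint $w=x$ is a violation at $x$; it is a top violation if $x$ is the more important endpoint in $G$, that is, $c_G(y)<c_G(x)$. Theorem. For every integer $k\ge 54$ there exists a real number $\nu_k\ge 0$ with \[ \nu_k<\frac1{k+\frac3{4k}}\qquad\text{and}\qquad \nu_k<\frac1{\rho'_k} \] such that for every $\alpha\in\bigl(\nu_k,\tfrac1{\rho'_k}\bigr)$ one has $\alpha<1/\rho_k$ (so that Katz's index with parameter $\alpha$ is defined on both $G_k$ and $G'_k$), and Katz's index with parameter $\alpha$ is not rank monotone on $G_k$; more precisely, adding the edge between $0$ and $1$ causes a top violation of rank monotonicity at vertex $1$. -/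

import Mathlib

/-! ## Katz's index and spectral radius of a finite simple graph -/

/-- The spectral radius of (the adjacency matrix of) a finite simple graph. -/
noncomputable def graphSpectralRadius {V : Type*} [Fintype V] [DecidableEq V]
    (G : SimpleGraph V) : ℝ :=
  open Classical in (spectralRadius ℂ (G.adjMatrix ℂ)).toReal

/-- Katz's index with attenuation factor `α`: the vector `𝟏 ∑ᵢ αⁱ Aⁱ`, where `𝟏` is the row vector
of ones and `A` the adjacency matrix. It is meaningful for `0 ≤ α < 1 / ρ(G)`. -/
noncomputable def katzIndex {V : Type*} [Fintype V] [DecidableEq V]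
    (α : ℝ) (G : SimpleGraph V) (x : V) : ℝ :=
  open Classical in
  ∑' i : ℕ, α ^ i * Matrix.vecMul (fun _ : V => (1 : ℝ)) (G.adjMatrix ℝ ^ i) x

/-! ## Rank monotonicity -/

/-- The graph obtained from `G` by adding the new edge `x — y`. -/
def addEdge {V : Type*} (G : SimpleGraph V) (x y : V) : SimpleGraph V :=
  G ⊔ SimpleGraph.edge x y

/-- The rank of `x` relative to `z` is preserved when passing from the scores `c` to the
scores `c'`: (strict) dominance of `x` over `z` is maintained. -/
def RankPreserved {V : Type*} (c c' : V → ℝ) (x z : V) : Prop :=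
  (c z < c x → c' z < c' x) ∧ (c z ≤ c x → c' z ≤ c' x)

/-- The centrality `c` is rank monotone on the undirected graph `G`. -/
def RankMonotoneOn {V : Type*} (c : SimpleGraph V → V → ℝ) (G : SimpleGraph V) : Prop :=
  ∀ x y : V, x ≠ y → ¬ G.Adj x y → ∀ z : V, z ≠ x → z ≠ y →
    RankPreserved (c G) (c (addEdge G x y)) x z ∧
    RankPreserved (c G) (c (addEdge G x y)) y z

/-- Adding the edge `x — y` between the non-adjacent vertices `x` and `y` causes a top violation
of rank monotonicity at `x`: the endpoint `x` is more important than the endpoint `y` in `G`, and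
its rank relative to some other vertex `z` is not preserved. -/
def TopRankViolation {V : Type*} (c : SimpleGraph V → V → ℝ) (G : SimpleGraph V) (x y : V) :
    Prop :=
  x ≠ y ∧ ¬ G.Adj x y ∧ c G y < c G x ∧
    ∃ z : V, z ≠ x ∧ z ≠ y ∧ ¬ RankPreserved (c G) (c (addEdge G x y)) x z

/-! ## The graphs `G_k` -/

/-- Number of vertices with a given label: one for each of the labels `0`, `1`, `2`, `3`,
`k` with label `4`, `(k - 1)(k - 2)` with label `5`, and `k` with label `6`. -/
def labelCount (k : ℕ) : Fin 7 → ℕ :=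
  ![1, 1, 1, 1, k, (k - 1) * (k - 2), k]

/-- The vertices of `G_k`: a label together with an index among the vertices with that label. -/
abbrev GVertex (k : ℕ) : Type := Σ l : Fin 7, Fin (labelCount k l)

/-- The vertex with label `0`. -/
def vertexZero (k : ℕ) : GVertex k := ⟨0, ⟨0, Nat.one_pos⟩⟩

/-- The vertex with label `1`. -/
def vertexOne (k : ℕ) : GVertex k := ⟨1, ⟨0, Nat.one_pos⟩⟩

/-- The pairs of labels such that distinct vertices carrying these labels are adjacent. -/
def labelEdges : Set (Sym2 (Fin 7)) :=
  {s(0, 3), s(0, 4), s(1, 2), s(1, 5), s(2, 3), s(2, 6), s(4, 4), s(6, 6)}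

/-- The graph `G_k`. There is a path `0 — 3 — 2 — 1`; the `k` vertices labeled `4` form a
`(k + 1)`-clique with vertex `0`; the `k` vertices labeled `6` form a `(k + 1)`-clique with
vertex `2`; the `(k - 1)(k - 2)` vertices labeled `5` are leaves attached to vertex `1`. -/
def katzGraph (k : ℕ) : SimpleGraph (GVertex k) where
  Adj v w := v ≠ w ∧ s(v.1, w.1) ∈ labelEdges
  symm := ⟨fun v w h => ⟨h.1.symm, by rw [Sym2.eq_swap]; exact h.2⟩⟩
  loopless := ⟨fun _ h => h.1 rfl⟩

/-- The graph `G'_k`, that is, `G_k` with the additional edge `0 — 1`. -/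
def katzGraph' (k : ℕ) : SimpleGraph (GVertex k) :=
  addEdge (katzGraph k) (vertexOne k) (vertexZero k)

/-! The comparison vertex z is one labeled 4: in G the scores satisfy c(z) < c(0) < c(1), while in
G' they satisfy c'(1) ≤ c'(z).

Put t = 1/α, s = t - k and x = αc, so that t x = 1 + A x. Eliminating the leaves and the clique
vertices leaves a linear system for the labels 0, 1, 2, 3, with coefficients q = (1 + s)t - k = s(k
+ 1 + s) and d = t² - (k-1)(k-2). The number of leaves makes d about 3k. If α is close to 1/ρ', then
c = ks is bounded, and to leading order q ≈ c and the term x₃ is negligible. In G this gives x₀ ≈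
k/c and x₁ ≈ k(1 + c)/(3c - 1), so x₀ < x₁ amounts to (1 - c)² > 0. In G' the vertices 0 and 2 get
the same score, c x₀ ≈ k + x₁ and 3x₁ ≈ 2x₀ + k. Hence x₀ is large, with a pole at c = 2/3, and x₁
is only about 2x₀/3, below x₄ = (1 + x₀)/(1 + s).

It remains to make this exact for k ≥ 54 and c ≤ 7501/10000 (`katz_score_zero_lt_one`,
`katz_score_one_le_four`), and to show that this range of c is reached before α = 1/ρ'. For that a
positive test vector gives ρ' ≤ k + 3/(4k) (`graphSpectralRadius_katzGraph'_le`), and 7501/10000 is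
slightly more than 3/4. -/

section SpectralRadius

/-! ### Spectral radius bounds and the linear system for Katz's index. -/

variable {V : Type*} [Fintype V]

open Classical in
/-- The sum of the values of `x` over the neighbours of `v`. -/
noncomputable def neighborSum (G : SimpleGraph V) (x : V → ℝ) (v : V) : ℝ :=
  ∑ w, if G.Adj v w then x w else 0

theorem neighborSum_mul_left (G : SimpleGraph V) (a : ℝ) (x : V → ℝ) (v : V) :
    neighborSum G (fun w => a * x w) v = a * neighborSum G x v := by
  rw [neighborSum, neighborSum, Finset.mul_sum]
  exact Finset.sum_congr rfl fun w _ => by split_ifs <;> simp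

theorem neighborSum_mono {G H : SimpleGraph V} (hGH : G ≤ H) {x : V → ℝ} (hx : ∀ v, 0 ≤ x v)
    (v : V) : neighborSum G x v ≤ neighborSum H x v := by
  refine Finset.sum_le_sum fun w _ => ?_
  by_cases hG : G.Adj v w
  · simp [hG, hGH hG]
  · rw [if_neg hG]
    split_ifs
    exacts [hx w, le_rfl]

variable [DecidableEq V]

/-- Collatz–Wielandt upper bound: for an eigenvector u, evaluate the eigenvalue equation at a vertex
maximizing ‖u v‖ / x v. -/
theorem spectralRadius_adjMatrix_le (G : SimpleGraph V) [DecidableRel G.Adj] {x : V → ℝ} {r : ℝ}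
    (hx : ∀ v, 0 < x v) (h : ∀ v, neighborSum G x v ≤ r * x v) :
    spectralRadius ℂ (G.adjMatrix ℂ) ≤ ENNReal.ofReal r := by
  refine iSup₂_le fun μ hμ => ?_
  rw [spectrum.mem_iff, Matrix.isUnit_iff_isUnit_det, isUnit_iff_ne_zero, not_not] at hμ
  obtain ⟨u, hu, hu'⟩ := Matrix.exists_mulVec_eq_zero_iff.mpr hμ
  have heig : ∀ v, μ * u v = ∑ w, if G.Adj v w then u w else 0 := by
    intro v
    have := congrFun hu' v
    rw [Matrix.sub_mulVec, Matrix.algebraMap_eq_diagonal] at this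
    simp only [Pi.sub_apply, Matrix.mulVec_diagonal, Pi.zero_apply, sub_eq_zero] at this
    simpa [Matrix.mulVec, dotProduct, SimpleGraph.adjMatrix_apply] using this
  obtain ⟨v₀, hv₀⟩ := Function.ne_iff.mp hu
  obtain ⟨v, -, hv⟩ := Finset.exists_max_image Finset.univ (fun v => ‖u v‖ / x v) ⟨v₀, by simp⟩
  have hpos : 0 < ‖u v‖ / x v :=
    (div_pos (norm_pos_iff.mpr hv₀) (hx v₀)).trans_le (hv v₀ (Finset.mem_univ _))
  have hle : ∀ w, ‖u w‖ ≤ ‖u v‖ / x v * x w := fun w =>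
    (div_le_iff₀ (hx w)).mp (hv w (Finset.mem_univ _))
  have key : ‖μ‖ * ‖u v‖ ≤ r * ‖u v‖ := by
    calc ‖μ‖ * ‖u v‖ = ‖∑ w, if G.Adj v w then u w else 0‖ := by rw [← norm_mul, heig]
      _ ≤ ∑ w, ‖if G.Adj v w then u w else 0‖ := norm_sum_le _ _
      _ ≤ ∑ w, ‖u v‖ / x v * (if G.Adj v w then x w else 0) := by
          refine Finset.sum_le_sum fun w _ => ?_
          split_ifs
          · exact hle w
          · simp
      _ = ‖u v‖ / x v * neighborSum G x v := by
          rw [← Finset.mul_sum, neighborSum]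
          congr!
      _ ≤ ‖u v‖ / x v * (r * x v) := mul_le_mul_of_nonneg_left (h v) hpos.le
      _ = r * ‖u v‖ := by field_simp [(hx v).ne']
  have huv : 0 < ‖u v‖ := by
    by_contra hn
    rw [le_antisymm (not_lt.mp hn) (norm_nonneg _), zero_div] at hpos
    exact hpos.false
  have hr : ‖μ‖ ≤ r := le_of_mul_le_mul_right key huv
  rw [← ENNReal.ofReal_coe_nnreal]
  exact ENNReal.ofReal_le_ofReal hr

theorem spectralRadius_adjMatrix_ne_top (G : SimpleGraph V) [DecidableRel G.Adj] :
    spectralRadius ℂ (G.adjMatrix ℂ) ≠ ⊤ := by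
  refine ne_top_of_le_ne_top ENNReal.ofReal_ne_top
    (spectralRadius_adjMatrix_le G (x := fun _ => 1) (r := Fintype.card V) (by simp) fun v => ?_)
  refine (Finset.sum_le_sum (g := fun _ => (1 : ℝ)) fun w _ => ?_).trans (by simp)
  split_ifs <;> norm_num

theorem graphSpectralRadius_le (G : SimpleGraph V) {x : V → ℝ} {r : ℝ} (hr : 0 ≤ r)
    (hx : ∀ v, 0 < x v) (h : ∀ v, neighborSum G x v ≤ r * x v) : graphSpectralRadius G ≤ r := by
  classical
  exact ENNReal.toReal_le_of_le_ofReal hr (spectralRadius_adjMatrix_le G hx h)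

theorem graphSpectralRadius_nonneg (G : SimpleGraph V) : 0 ≤ graphSpectralRadius G :=
  ENNReal.toReal_nonneg

-- Gelfand's formula for the ℓ∞ operator norm, which dominates every entry. This is what makes the
-- Katz series converge.
attribute [local instance] Matrix.linftyOpNormedRing Matrix.linftyOpNormedAlgebra in
theorem exists_adjMatrix_pow_le (G : SimpleGraph V) [DecidableRel G.Adj] {t : ℝ}
    (ht : graphSpectralRadius G < t) :
    ∃ N : ℕ, ∀ n ≥ N, ∀ i j, (G.adjMatrix ℝ ^ n) i j ≤ t ^ n := by
  have h0 := graphSpectralRadius_nonneg G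
  have hlt : spectralRadius ℂ (G.adjMatrix ℂ) < ENNReal.ofReal t := by
    rw [ENNReal.lt_ofReal_iff_toReal_lt (spectralRadius_adjMatrix_ne_top G)]
    convert ht
    unfold graphSpectralRadius
    congr!
  have hG := (spectrum.pow_nnnorm_pow_one_div_tendsto_nhds_spectralRadius
    (G.adjMatrix ℂ)).eventually_lt_const hlt
  obtain ⟨N, hN⟩ := Filter.eventually_atTop.mp (hG.and (Filter.eventually_gt_atTop 0))
  refine ⟨N, fun n hn i j => ?_⟩
  obtain ⟨h1, h2⟩ := hN n hn
  have h3 : (‖G.adjMatrix ℂ ^ n‖₊ : ENNReal) ≤ ENNReal.ofReal t ^ n := by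
    have := ENNReal.rpow_le_rpow h1.le (Nat.cast_nonneg (α := ℝ) n)
    rwa [← ENNReal.rpow_mul, one_div_mul_cancel (by positivity), ENNReal.rpow_one,
      ENNReal.rpow_natCast] at this
  have h4 : ‖G.adjMatrix ℂ ^ n‖ ≤ t ^ n := by
    rw [← ENNReal.ofReal_pow (h0.trans ht.le), ← ENNReal.ofReal_coe_nnreal,
      ENNReal.ofReal_le_ofReal_iff (pow_nonneg (h0.trans ht.le) n)] at h3
    exact h3
  have h5 : (G.adjMatrix ℂ ^ n) i j = (((G.adjMatrix ℝ ^ n) i j : ℝ) : ℂ) := by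
    have : G.adjMatrix ℂ = (algebraMap ℝ ℂ).mapMatrix (G.adjMatrix ℝ) := by
      ext i j
      simp [SimpleGraph.adjMatrix_apply, apply_ite]
    rw [this, ← map_pow]
    rfl
  have h6 : ‖(G.adjMatrix ℂ ^ n) i j‖ ≤ ‖G.adjMatrix ℂ ^ n‖ := by
    rw [Matrix.linfty_opNorm_def]
    have a := Finset.single_le_sum (f := fun j => ‖(G.adjMatrix ℂ ^ n) i j‖₊)
      (fun _ _ => zero_le) (Finset.mem_univ j)
    have b := Finset.le_sup (f := fun i => ∑ j, ‖(G.adjMatrix ℂ ^ n) i j‖₊) (Finset.mem_univ i)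
    exact_mod_cast a.trans b
  rw [h5, Complex.norm_real] at h6
  exact (le_abs_self _).trans (h6.trans h4)

theorem vecMul_adjMatrix_pow_nonneg (G : SimpleGraph V) [DecidableRel G.Adj] (n : ℕ) (v : V) :
    0 ≤ Matrix.vecMul (fun _ : V => (1 : ℝ)) (G.adjMatrix ℝ ^ n) v := by
  induction n generalizing v with
  | zero => simp
  | succ n ih =>
    rw [pow_succ, ← Matrix.vecMul_vecMul]
    refine Finset.sum_nonneg fun w _ => mul_nonneg (ih w) ?_
    change 0 ≤ G.adjMatrix ℝ w v
    rw [SimpleGraph.adjMatrix_apply]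
    split_ifs <;> norm_num

theorem vecMul_adjMatrix_pow_succ (G : SimpleGraph V) [DecidableRel G.Adj] (n : ℕ) (v : V) :
    Matrix.vecMul (fun _ : V => (1 : ℝ)) (G.adjMatrix ℝ ^ (n + 1)) v =
      ∑ w, if G.Adj v w then Matrix.vecMul (fun _ : V => (1 : ℝ)) (G.adjMatrix ℝ ^ n) w else 0 := by
  rw [pow_succ, ← Matrix.vecMul_vecMul, Matrix.vecMul, dotProduct]
  refine Finset.sum_congr rfl fun w _ => ?_
  rw [SimpleGraph.adjMatrix_apply]
  simp [G.adj_comm v w]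

theorem summable_katz (G : SimpleGraph V) [DecidableRel G.Adj] {α : ℝ} (hα : 0 < α)
    (h : graphSpectralRadius G < 1 / α) (v : V) :
    Summable fun n : ℕ => α ^ n * Matrix.vecMul (fun _ : V => (1 : ℝ)) (G.adjMatrix ℝ ^ n) v := by
  obtain ⟨r, hr, hrα⟩ := exists_between h
  have hr0 : 0 ≤ r := (graphSpectralRadius_nonneg G).trans hr.le
  obtain ⟨N, hN⟩ := exists_adjMatrix_pow_le G hr
  have hlt : α * r < 1 := by rwa [lt_div_iff₀ hα, mul_comm] at hrα
  have hgeom : Summable fun n : ℕ => (Fintype.card V : ℝ) * (α * r) ^ n :=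
    (summable_geometric_of_lt_one (by positivity) hlt).mul_left _
  refine hgeom.of_norm_bounded_eventually_nat (Filter.eventually_atTop.mpr ⟨N, fun n hn => ?_⟩)
  rw [Real.norm_of_nonneg (mul_nonneg (by positivity) (vecMul_adjMatrix_pow_nonneg G n v))]
  have : Matrix.vecMul (fun _ : V => (1 : ℝ)) (G.adjMatrix ℝ ^ n) v ≤ Fintype.card V * r ^ n := by
    rw [Matrix.vecMul, dotProduct]
    refine (Finset.sum_le_sum (g := fun _ => r ^ n) fun w _ => ?_).trans (by simp)
    rw [one_mul]
    exact hN n hn w v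
  calc _ ≤ α ^ n * (Fintype.card V * r ^ n) := by gcongr
    _ = _ := by rw [mul_pow]; ring

theorem one_le_katzIndex (G : SimpleGraph V) {α : ℝ} (hα : 0 < α)
    (h : graphSpectralRadius G < 1 / α) (v : V) : 1 ≤ katzIndex α G v := by
  classical
  have := (summable_katz G hα h v).le_tsum 0 fun n _ =>
    mul_nonneg (by positivity) (vecMul_adjMatrix_pow_nonneg G n v)
  simp only [pow_zero, Matrix.vecMul_one, mul_one] at this
  unfold katzIndex
  convert this

/-- Split off the term i = 0 of the series; since A is symmetric, the row vector recursion becomes a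
sum over neighbours. -/
theorem katzIndex_eq (G : SimpleGraph V) {α : ℝ} (hα : 0 < α)
    (h : graphSpectralRadius G < 1 / α) (v : V) :
    katzIndex α G v = 1 + α * neighborSum G (katzIndex α G) v := by
  classical
  have hs := summable_katz G hα h
  have hk : ∀ w, katzIndex α G w = ∑' n : ℕ, α ^ n *
      Matrix.vecMul (fun _ : V => (1 : ℝ)) (G.adjMatrix ℝ ^ n) w := by
    intro w
    unfold katzIndex
    congr!
  rw [hk, (hs v).tsum_eq_zero_add]
  congr 1
  · simp
  · have h1 : ∀ w ∈ Finset.univ, Summable fun n : ℕ => if G.Adj v w then α ^ n *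
        Matrix.vecMul (fun _ : V => (1 : ℝ)) (G.adjMatrix ℝ ^ n) w else 0 := by
      intro w _
      split_ifs
      · exact hs w
      · exact summable_zero
    have h2 : neighborSum G (katzIndex α G) v = ∑' n : ℕ, ∑ w, if G.Adj v w then α ^ n *
        Matrix.vecMul (fun _ : V => (1 : ℝ)) (G.adjMatrix ℝ ^ n) w else 0 := by
      rw [Summable.tsum_finsetSum h1, neighborSum]
      refine Finset.sum_congr rfl fun w _ => ?_
      rw [hk]
      split_ifs <;> simp
    rw [h2, ← tsum_mul_left]
    refine tsum_congr fun n => ?_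
    rw [vecMul_adjMatrix_pow_succ, Finset.mul_sum, Finset.mul_sum]
    refine Finset.sum_congr rfl fun w _ => ?_
    split_ifs
    · ring
    · ring

/-- Perron–Frobenius is avoided: for t > ρ(H), the Katz vector c of H at 1/t is positive and A_H c ≤
t c. Then A_G c ≤ t c as well, and the Collatz–Wielandt bound gives ρ(G) ≤ t. -/
theorem graphSpectralRadius_mono {G H : SimpleGraph V} (hGH : G ≤ H) :
    graphSpectralRadius G ≤ graphSpectralRadius H := by
  refine le_of_forall_gt_imp_ge_of_dense fun t ht => ?_
  have ht0 : 0 < t := (graphSpectralRadius_nonneg H).trans_lt ht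
  have ht' : graphSpectralRadius H < 1 / t⁻¹ := by simpa using ht
  have hpos := fun v => zero_lt_one.trans_le (one_le_katzIndex H (inv_pos.mpr ht0) ht' v)
  refine graphSpectralRadius_le G ht0.le hpos fun v =>
    (neighborSum_mono hGH (fun v => (hpos v).le) v).trans ?_
  have := katzIndex_eq H (inv_pos.mpr ht0) ht' v
  rw [this, mul_add, ← mul_assoc, mul_inv_cancel₀ ht0.ne']
  linarith

end SpectralRadius

/-! ### Inequalities for the quotient systems. -/

section Algebra

/-- The polynomial inequality that separates the scores of the vertices `1` and `0` of `G_k`. -/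
theorem katz_separating_inequality {k s : ℝ} (hk : 54 ≤ k) (hs : 0 < s)
    (hs' : k * s ≤ 7501 / 10000) {t q d : ℝ} (ht : t = k + s) (hq : q = s * (k + 1 + s))
    (hd : d = t ^ 2 - (k - 1) * (k - 2)) :
    (d * q - t * (1 + s) - q * t) * ((1 + s + k) * t + 1 + s) <
      (t + (k - 1) * (k - 2)) * (q ^ 2 * t - (1 + s) * (2 * q + 1 + s)) := by
  -- With k = 54 + m and ks = 7501/10000 - u, the region becomes m ≥ 0, 0 ≤ u ≤ 1, and the factor
  -- (54 + m)^5 clears the denominators coming from s.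
  obtain ⟨m, hm, rfl⟩ : ∃ m : ℝ, 0 ≤ m ∧ k = 54 + m := ⟨k - 54, by linarith, by ring⟩
  obtain ⟨u, hu, hsu⟩ : ∃ u : ℝ, 0 ≤ u ∧ s = (7501 / 10000 - u) / (54 + m) :=
    ⟨7501 / 10000 - (54 + m) * s, by linarith, by field_simp; ring⟩
  have hu1 : u ≤ 1 := by
    have : 0 < (54 + m) * s := by positivity
    rw [hsu] at this
    field_simp at this
    linarith
  rw [← sub_pos]
  have hpow : 0 < (54 + m) ^ 5 := by positivity
  refine pos_of_mul_pos_right ?_ hpow.le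
  subst hd hq ht
  -- The expanded polynomial has negative coefficients only at u³ and u⁵; they are absorbed into
  -- u²(1 - u) and u²(1 - u³). The coefficient of m^8 is (2499/10000 + u)² = (1 - ks)², the
  -- leading-order margin.
  have e2 : 0 ≤ u ^ 2 * (1 - u) := mul_nonneg (by positivity) (by linarith)
  have e4 : 0 ≤ u ^ 2 * (1 - u ^ 3) :=
    mul_nonneg (by positivity) (by linarith [pow_le_one₀ hu hu1 (n := 3)])
  have key : (54 + m) ^ 5 * ((54 + m + s + (54 + m - 1) * (54 + m - 2)) *
      ((s * (54 + m + 1 + s)) ^ 2 * (54 + m + s) -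
        (1 + s) * (2 * (s * (54 + m + 1 + s)) + 1 + s)) -
      (((54 + m + s) ^ 2 - (54 + m - 1) * (54 + m - 2)) * (s * (54 + m + 1 + s)) -
        (54 + m + s) * (1 + s) - s * (54 + m + 1 + s) * (54 + m + s)) *
        ((1 + s + (54 + m)) * (54 + m + s) + 1 + s)) =
      (439625357309596680758554103851 / 50000000000000000000 +
        44395258772660552802184216649 / 1000000000000000 * u +
        3470702010717672042702851 / 50000000000 * u ^ 2 +
        353242939880392351 / 5000000 * (u ^ 2 * (1 - u)) +
        23933321851 / 1000 * u ^ 4 +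
        2702 * (u ^ 2 * (1 - u ^ 3))) +
      (1056286924163992314380140065013 / 12500000000000000000 +
        1604979736121750171465447987 / 250000000000000 * u +
        129262933311848207659013 / 12500000000 * u ^ 2 +
        9900319939776013 / 1250000 * (u ^ 2 * (1 - u)) +
        450513013 / 250 * u ^ 4 +
        104 * (u ^ 2 * (1 - u ^ 3))) * m +
      (1087448449892870742234121177501 / 100000000000000000000 +
        811997886271906378175557999 / 2000000000000000 * u +
        67390149764110678946501 / 100000000000 * u ^ 2 +
        3699145439721001 / 10000000 * (u ^ 2 * (1 - u)) +
        101735501 / 2000 * u ^ 4 +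
        1 * (u ^ 2 * (1 - u ^ 3))) * m ^ 2 +
      (3014200049855682490135319 / 5000000000000000 +
        1833197417280051148431 / 125000000000 * u +
        627292452253823457 / 25000000 * u ^ 2 +
        11516284069 / 1250 * (u ^ 2 * (1 - u)) +
        638 * u ^ 4) * m ^ 3 +
      (185901562677640803030003 / 10000000000000000 +
        82737573476150852497 / 250000000000 * u +
        29191369041985009 / 50000000 * u ^ 2 +
        322632503 / 2500 * (u ^ 2 * (1 - u)) +
        3 * u ^ 4) * m ^ 4 +
      (86035679603227741 / 250000000000 +
        119439287294277 / 25000000 * u +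
        21732068223 / 2500 * u ^ 2 +
        964 * (u ^ 2 * (1 - u))) * m ^ 5 +
      (3823456340117503 / 1000000000000 +
        4308476014991 / 100000000 * u +
        808837509 / 10000 * u ^ 2 +
        3 * (u ^ 2 * (1 - u))) * m ^ 6 +
      (236028043 / 10000000 +
        110957 / 500 * u +
        430 * u ^ 2) * m ^ 7 +
      (6245001 / 100000000 +
        2499 / 5000 * u +
        1 * u ^ 2) * m ^ 8 := by
    rw [hsu]
    field_simp
    ring
  rw [key]
  positivity

/-- A positive solution of the quotient Katz system of `G_k` scores `1` above `0`. -/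
theorem katz_score_zero_lt_one {k s x₀ x₁ x₂ x₃ t q d : ℝ} (hk : 54 ≤ k) (hs : 0 < s)
    (hs' : k * s ≤ 7501 / 10000) (ht : t = k + s) (hq : q = s * (k + 1 + s))
    (hd : d = t ^ 2 - (k - 1) * (k - 2)) (h₀ : 0 < x₀) (h₁ : 0 < x₁)
    (e₀ : q * x₀ = (1 + s) * (1 + x₃) + k) (e₂ : q * x₂ = (1 + s) * (1 + x₁ + x₃) + k)
    (e₃ : t * x₃ = 1 + x₀ + x₂) (e₁ : d * x₁ = t * (1 + x₂) + (k - 1) * (k - 2)) :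
    x₀ < x₁ := by
  -- If x₁ ≤ x₀, the equations at 1 and 2 bound x₀ from below, q(t + N) ≤ E x₀, and those at 0, 2
  -- and 3 bound it from above, Λ x₀ ≤ q M. Together they force (t + N)Λ ≤ E M, against the
  -- separating inequality.
  by_contra! hle
  have key := katz_separating_inequality hk hs hs' ht hq hd
  have ht0 : 0 < t := by rw [ht]; linarith
  have hq0 : 0 < q := by rw [hq]; exact mul_pos hs (by linarith)
  have hN : 0 < (k - 1) * (k - 2) := mul_pos (by linarith) (by linarith)
  set N := (k - 1) * (k - 2)
  set E := d * q - t * (1 + s) - q * t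
  set M := (1 + s + k) * t + 1 + s with hMdef
  set Λ := q ^ 2 * t - (1 + s) * (2 * q + 1 + s) with hΛ
  have hM : 0 < M := by positivity
  have e₂₀ : q * x₂ = q * x₀ + (1 + s) * x₁ := by rw [e₂, e₀]; ring
  have a₁ : (d * q - t * (1 + s)) * x₁ = q * (t + N) + q * t * x₀ := by
    linear_combination q * e₁ + t * e₂₀
  have a₂ : 0 < d * q - t * (1 + s) := by
    refine pos_of_mul_pos_left ?_ h₁.le
    rw [a₁]
    positivity
  have a₃ : q * (t + N) ≤ E * x₀ := by
    have := mul_le_mul_of_nonneg_left hle a₂.le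
    linarith [show E * x₀ = (d * q - t * (1 + s)) * x₀ - q * t * x₀ by ring]
  have hE : 0 < E := pos_of_mul_pos_left (lt_of_lt_of_le (by positivity) a₃) h₀.le
  have a₄ : q ^ 2 * t * x₀ = q * M + (1 + s) * (2 * q * x₀ + (1 + s) * x₁) := by
    rw [hMdef]
    linear_combination q * t * e₀ + q * (1 + s) * e₃ + (1 + s) * e₂₀
  have a₅ : Λ * x₀ ≤ q * M := by
    have : (1 + s) * ((1 + s) * x₁) ≤ (1 + s) * ((1 + s) * x₀) := by gcongr
    rw [hΛ]
    linarith
  have b₁ := mul_le_mul_of_nonneg_left a₅ hE.le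
  have b₂ := mul_lt_mul_of_pos_left key hq0
  have hΛ0 : 0 < Λ := pos_of_mul_pos_right ((mul_pos hE hM).trans key) (by positivity)
  have b₃ := mul_le_mul_of_nonneg_left a₃ hΛ0.le
  linarith

/-- In a positive solution of the quotient Katz system of `G'_k`, the score of `1` is below that
of the vertices labeled `4`. -/
theorem katz_score_one_le_four {k s x₀ x₁ x₃ t q d : ℝ} (hk : 54 ≤ k) (hs : 0 < s)
    (hs' : k * s ≤ 7501 / 10000) (ht : t = k + s) (hq : q = s * (k + 1 + s))
    (hd : d = t ^ 2 - (k - 1) * (k - 2)) (h₀ : 0 < x₀) (h₁ : 0 < x₁) (h₃ : 0 < x₃)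
    (e₀ : q * x₀ = (1 + s) * (1 + x₁ + x₃) + k)
    (e₁ : d * x₁ = t * (1 + 2 * x₀) + (k - 1) * (k - 2)) :
    (1 + s) * x₁ ≤ 1 + x₀ := by
  have hs1 : s ≤ 14 / 1000 := by nlinarith
  have hss : s ^ 2 ≤ s := by nlinarith
  have hd' : d = 3 * k - 2 + 2 * (k * s) + s ^ 2 := by rw [hd, ht]; ring
  have hd0 : 0 < d := by rw [hd']; nlinarith [mul_pos (by linarith : 0 < k) hs]
  have hd1 : d ≤ 3 * k := by linarith
  have hq1 : q ≤ 766 / 1000 := by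
    have : q = k * s + s + s ^ 2 := by rw [hq]; ring
    nlinarith
  have hN : 0 < (k - 1) * (k - 2) := mul_pos (by linarith) (by linarith)
  -- Since d ≤ 3k, the score x₁ is at least 2x₀/3. Fed back into x₁ + k ≤ q x₀ with q ≤ 0.766 < 1,
  -- this leaves k ≤ 0.0994 x₀, hence x₀ ≥ 10k.
  have c₁ : 2 * x₀ ≤ 3 * x₁ := by
    have h1 : k * (2 * x₀) ≤ d * x₁ := by
      rw [e₁, ht]
      nlinarith [mul_pos hs h₀]
    have h2 : d * x₁ ≤ 3 * k * x₁ := by gcongr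
    refine le_of_mul_le_mul_left (a := k) ?_ (by linarith)
    linarith
  have c₂ : 10 * k ≤ x₀ := by
    have h1 : q * x₀ ≤ 766 / 1000 * x₀ := by gcongr
    have h2 : x₁ + k ≤ q * x₀ := by
      rw [e₀]
      nlinarith [mul_pos hs h₁, mul_pos hs h₃]
    linarith
  refine le_of_mul_le_mul_left (a := d) ?_ hd0
  -- The gap between the coefficients of x₀ is about k, so it contributes about 10k², which
  -- outweighs the leaf term (1 + s)(t + (k-1)(k-2)), of size about k².
  have hl : k - 5 ≤ d - 2 * t * (1 + s) := by
    rw [hd', ht]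
    nlinarith
  have hmain : (k - 5) * (10 * k) ≤ (d - 2 * t * (1 + s)) * x₀ := by
    refine mul_le_mul hl c₂ (by linarith) ?_
    linarith
  have hr : (1 + s) * (t + (k - 1) * (k - 2)) ≤ 2 * (k ^ 2 - 2 * k + 3) := by
    have : t + (k - 1) * (k - 2) ≤ k ^ 2 - 2 * k + 3 := by rw [ht]; nlinarith
    refine mul_le_mul (by linarith) this ?_ (by norm_num)
    rw [ht]
    linarith
  have : d * ((1 + s) * x₁) = (1 + s) * (t + (k - 1) * (k - 2)) + 2 * t * (1 + s) * x₀ := by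
    linear_combination (1 + s) * e₁
  rw [this]
  nlinarith

/-- The quotient inequality satisfied by the test vector for the spectral radius of `G'_k`. -/
theorem katz_test_vector_inequality {k s t d : ℝ} (hk : 54 ≤ k) (hks : k * s = 3 / 4)
    (ht : t = k + s) (hd : d = t ^ 2 - (k - 1) * (k - 2)) :
    2 * t / d + 2 / t + k / (1 + s) ≤ t := by
  have hs : 0 < s := by
    refine pos_of_mul_pos_right (a := k) ?_ (by linarith)
    rw [hks]; norm_num
  have hs1 : s ≤ 14 / 1000 := by nlinarith
  have hd' : d = 3 * k - 1 / 2 + s ^ 2 := by rw [hd, ht]; linear_combination 2 * hks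
  have ht0 : 0 < t := by rw [ht]; linarith
  have hd0 : 0 < d := by rw [hd']; nlinarith
  -- The terms are about 2/3, 2/k and k - ks, so ks must exceed 2/3 by a margin; 3/4 leaves room for
  -- the lower-order terms, and 0.68 + 0.04 = 0.72.
  have h1 : 2 * t / d ≤ 68 / 100 := by
    rw [div_le_iff₀ hd0, hd', ht]
    nlinarith
  have h2 : 2 / t ≤ 4 / 100 := by
    rw [div_le_iff₀ ht0, ht]
    linarith
  have h3 : k / (1 + s) ≤ t - 72 / 100 := by
    rw [div_le_iff₀ (by linarith), ht]
    nlinarith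
  linarith

end Algebra

/-! ### Neighbour sums in the two graphs and the quotient by labels. -/

section KatzGraph

/-- The vertex with label `2`. -/
def vertexTwo (k : ℕ) : GVertex k := ⟨2, ⟨0, Nat.one_pos⟩⟩

/-- The vertex with label `3`. -/
def vertexThree (k : ℕ) : GVertex k := ⟨3, ⟨0, Nat.one_pos⟩⟩

variable {k : ℕ}

/-- The sum of the values of `x` over the vertices labeled `l`. -/
def labelSum (x : GVertex k → ℝ) (l : Fin 7) : ℝ := ∑ i, x ⟨l, i⟩

-- The sum over labels counts v itself when its own label spans a clique (labels 4 and 6); the last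
-- term removes it.
open Classical in
theorem neighborSum_katzGraph (x : GVertex k → ℝ) (v : GVertex k) :
    neighborSum (katzGraph k) x v =
      (∑ l, if s(v.1, l) ∈ labelEdges then labelSum x l else 0) -
        if s(v.1, v.1) ∈ labelEdges then x v else 0 := by
  have h1 : ∀ w, (if (katzGraph k).Adj v w then x w else 0) =
      (if s(v.1, w.1) ∈ labelEdges then x w else 0) -
        if v = w then (if s(v.1, v.1) ∈ labelEdges then x v else 0) else 0 := by
    intro w
    by_cases hvw : v = w
    · subst hvw
      simp
    · simp [katzGraph, hvw]
  rw [neighborSum, Finset.sum_congr rfl fun w _ => h1 w, Finset.sum_sub_distrib,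
    Finset.sum_ite_eq, if_pos (Finset.mem_univ v), Fintype.sum_sigma]
  congr 1
  refine Finset.sum_congr rfl fun l _ => ?_
  split_ifs <;> simp [labelSum]

theorem labelSum_of_const {x : GVertex k → ℝ} {l : Fin 7} {c : ℝ} (h : ∀ i, x ⟨l, i⟩ = c) :
    labelSum x l = labelCount k l * c := by
  simp [labelSum, h]

theorem labelSum_zero (x : GVertex k → ℝ) : labelSum x 0 = x (vertexZero k) :=
  Fin.sum_univ_one fun i : Fin 1 => x ⟨0, i⟩

theorem labelSum_one (x : GVertex k → ℝ) : labelSum x 1 = x (vertexOne k) :=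
  Fin.sum_univ_one fun i : Fin 1 => x ⟨1, i⟩

theorem labelSum_two (x : GVertex k → ℝ) : labelSum x 2 = x (vertexTwo k) :=
  Fin.sum_univ_one fun i : Fin 1 => x ⟨2, i⟩

theorem labelSum_three (x : GVertex k → ℝ) : labelSum x 3 = x (vertexThree k) :=
  Fin.sum_univ_one fun i : Fin 1 => x ⟨3, i⟩

theorem neighborSum_vertexZero (x : GVertex k → ℝ) :
    neighborSum (katzGraph k) x (vertexZero k) = x (vertexThree k) + labelSum x 4 := by
  rw [neighborSum_katzGraph, ← labelSum_three x]
  simp [vertexZero, labelEdges, Fin.sum_univ_seven]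

theorem neighborSum_vertexOne (x : GVertex k → ℝ) :
    neighborSum (katzGraph k) x (vertexOne k) = x (vertexTwo k) + labelSum x 5 := by
  rw [neighborSum_katzGraph, ← labelSum_two x]
  simp [vertexOne, labelEdges, Fin.sum_univ_seven]

theorem neighborSum_vertexTwo (x : GVertex k → ℝ) :
    neighborSum (katzGraph k) x (vertexTwo k) =
      x (vertexOne k) + x (vertexThree k) + labelSum x 6 := by
  rw [neighborSum_katzGraph, ← labelSum_one x, ← labelSum_three x]
  simp [vertexTwo, labelEdges, Fin.sum_univ_seven]

theorem neighborSum_vertexThree (x : GVertex k → ℝ) :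
    neighborSum (katzGraph k) x (vertexThree k) = x (vertexZero k) + x (vertexTwo k) := by
  rw [neighborSum_katzGraph, ← labelSum_zero x, ← labelSum_two x]
  simp [vertexThree, labelEdges, Fin.sum_univ_seven]

theorem neighborSum_label_four (x : GVertex k → ℝ) (i : Fin (labelCount k 4)) :
    neighborSum (katzGraph k) x ⟨4, i⟩ = x (vertexZero k) + labelSum x 4 - x ⟨4, i⟩ := by
  rw [neighborSum_katzGraph, ← labelSum_zero x]
  simp [labelEdges, Fin.sum_univ_seven]

theorem neighborSum_label_five (x : GVertex k → ℝ) (i : Fin (labelCount k 5)) :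
    neighborSum (katzGraph k) x ⟨5, i⟩ = x (vertexOne k) := by
  rw [neighborSum_katzGraph, ← labelSum_one x]
  simp [labelEdges]

theorem neighborSum_label_six (x : GVertex k → ℝ) (i : Fin (labelCount k 6)) :
    neighborSum (katzGraph k) x ⟨6, i⟩ = x (vertexTwo k) + labelSum x 6 - x ⟨6, i⟩ := by
  rw [neighborSum_katzGraph, ← labelSum_two x]
  simp [labelEdges, Fin.sum_univ_seven]

theorem vertexOne_ne_vertexZero : vertexOne k ≠ vertexZero k := by
  intro h
  simpa [vertexOne, vertexZero] using congrArg Sigma.fst h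

theorem not_adj_vertexOne_vertexZero : ¬ (katzGraph k).Adj (vertexOne k) (vertexZero k) := by
  simp [katzGraph, vertexOne, vertexZero, labelEdges]

open Classical in
theorem neighborSum_katzGraph' (x : GVertex k → ℝ) (v : GVertex k) :
    neighborSum (katzGraph' k) x v = neighborSum (katzGraph k) x v +
      (if v = vertexZero k then x (vertexOne k) else 0) +
      if v = vertexOne k then x (vertexZero k) else 0 := by
  have h1 : ∀ w, (if (katzGraph' k).Adj v w then x w else 0) =
      (if (katzGraph k).Adj v w then x w else 0) +
        (if w = vertexOne k then (if v = vertexZero k then x (vertexOne k) else 0) else 0) +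
        if w = vertexZero k then (if v = vertexOne k then x (vertexZero k) else 0) else 0 := by
    intro w
    have hne := vertexOne_ne_vertexZero (k := k)
    have hna := not_adj_vertexOne_vertexZero (k := k)
    have hna' : ¬ (katzGraph k).Adj (vertexZero k) (vertexOne k) := fun h => hna h.symm
    by_cases h1 : v = vertexOne k
    · by_cases h2 : w = vertexZero k
      · subst h1 h2
        simp [katzGraph', addEdge, SimpleGraph.edge_adj, hne, hne.symm, hna]
      · subst h1
        simp [katzGraph', addEdge, SimpleGraph.edge_adj, hne, h2]
    · by_cases h2 : v = vertexZero k
      · by_cases h3 : w = vertexOne k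
        · subst h2 h3
          simp [katzGraph', addEdge, SimpleGraph.edge_adj, hne, hne.symm, hna']
        · subst h2
          simp [katzGraph', addEdge, SimpleGraph.edge_adj, hne.symm, h3]
      · simp [katzGraph', addEdge, SimpleGraph.edge_adj, h1, h2]
  simp only [neighborSum, h1, Finset.sum_add_distrib, Finset.sum_ite_eq', Finset.mem_univ, if_true]

theorem eq_vertexZero (i : Fin (labelCount k 0)) : (⟨0, i⟩ : GVertex k) = vertexZero k := by
  have : i = ⟨0, Nat.one_pos⟩ := Subsingleton.elim (α := Fin 1) _ _
  rw [this, vertexZero]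

theorem eq_vertexOne (i : Fin (labelCount k 1)) : (⟨1, i⟩ : GVertex k) = vertexOne k := by
  have : i = ⟨0, Nat.one_pos⟩ := Subsingleton.elim (α := Fin 1) _ _
  rw [this, vertexOne]

theorem eq_vertexTwo (i : Fin (labelCount k 2)) : (⟨2, i⟩ : GVertex k) = vertexTwo k := by
  have : i = ⟨0, Nat.one_pos⟩ := Subsingleton.elim (α := Fin 1) _ _
  rw [this, vertexTwo]

theorem eq_vertexThree (i : Fin (labelCount k 3)) : (⟨3, i⟩ : GVertex k) = vertexThree k := by
  have : i = ⟨0, Nat.one_pos⟩ := Subsingleton.elim (α := Fin 1) _ _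
  rw [this, vertexThree]

theorem labelCount_five_cast (hk : 2 ≤ k) :
    (labelCount k 5 : ℝ) = ((k : ℝ) - 1) * ((k : ℝ) - 2) := by
  have : labelCount k 5 = (k - 1) * (k - 2) := rfl
  rw [this, Nat.cast_mul, Nat.cast_sub (by omega), Nat.cast_sub hk]
  norm_num

open Classical in
/-- A positive solution of the Katz system of `G_k`, with additional right-hand sides `b₀` and `b₁`
at the vertices `0` and `1`, satisfies the system of the quotient by labels. -/
theorem katz_quotient_system (hk : 2 ≤ k) {x : GVertex k → ℝ} {t b₀ b₁ s q d : ℝ} (ht : 0 < t)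
    (hx : ∀ v, 0 < x v) (hb₀ : 0 ≤ b₀)
    (h : ∀ v, t * x v = 1 + neighborSum (katzGraph k) x v +
      (if v = vertexZero k then b₀ else 0) + if v = vertexOne k then b₁ else 0)
    (hs : s = t - k) (hq : q = s * (k + 1 + s)) (hd : d = t ^ 2 - ((k : ℝ) - 1) * ((k : ℝ) - 2)) :
    0 < s ∧ (∀ i, (1 + s) * x ⟨4, i⟩ = 1 + x (vertexZero k)) ∧
      q * x (vertexZero k) = (1 + s) * (1 + b₀ + x (vertexThree k)) + k ∧
      q * x (vertexTwo k) = (1 + s) * (1 + x (vertexOne k) + x (vertexThree k)) + k ∧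
      t * x (vertexThree k) = 1 + x (vertexZero k) + x (vertexTwo k) ∧
      d * x (vertexOne k) = t * (1 + b₁ + x (vertexTwo k)) + ((k : ℝ) - 1) * ((k : ℝ) - 2) := by
  -- The terms b₀ and b₁ let one elimination serve both graphs: they vanish for G, and for G' they
  -- are the contributions x₁ and x₀ of the new edge.
  have l4 : (labelCount k 4 : ℝ) = k := rfl
  have l6 : (labelCount k 6 : ℝ) = k := rfl
  have hne : ∀ (l : Fin 7) (i : Fin (labelCount k l)), l ≠ 0 → l ≠ 1 →
      (⟨l, i⟩ : GVertex k) ≠ vertexZero k ∧ (⟨l, i⟩ : GVertex k) ≠ vertexOne k :=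
    fun l i h0 h1 => ⟨fun h => h0 (congrArg Sigma.fst h), fun h => h1 (congrArg Sigma.fst h)⟩
  have g : ∀ (l : Fin 7) (i : Fin (labelCount k l)), l ≠ 0 → l ≠ 1 →
      t * x ⟨l, i⟩ = 1 + neighborSum (katzGraph k) x ⟨l, i⟩ := by
    intro l i h0 h1
    rw [h, if_neg (hne l i h0 h1).1, if_neg (hne l i h0 h1).2, add_zero, add_zero]
  have f4 : ∀ i, (1 + t) * x ⟨4, i⟩ = 1 + x (vertexZero k) + labelSum x 4 := by
    intro i
    have := g 4 i (by decide) (by decide)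
    rw [neighborSum_label_four] at this
    linarith
  have f6 : ∀ i, (1 + t) * x ⟨6, i⟩ = 1 + x (vertexTwo k) + labelSum x 6 := by
    intro i
    have := g 6 i (by decide) (by decide)
    rw [neighborSum_label_six] at this
    linarith
  have f5 : ∀ i, t * x ⟨5, i⟩ = 1 + x (vertexOne k) := by
    intro i
    rw [g 5 i (by decide) (by decide), neighborSum_label_five]
  have f0 := h (vertexZero k)
  rw [neighborSum_vertexZero, if_pos rfl, if_neg vertexOne_ne_vertexZero.symm, add_zero] at f0
  have f1 := h (vertexOne k)
  rw [neighborSum_vertexOne, if_pos rfl, if_neg vertexOne_ne_vertexZero, add_zero] at f1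
  have f2 : t * x (vertexTwo k) = _ := g 2 ⟨0, Nat.one_pos⟩ (by decide) (by decide)
  rw [show (⟨2, ⟨0, Nat.one_pos⟩⟩ : GVertex k) = vertexTwo k from rfl,
    neighborSum_vertexTwo] at f2
  have f3 : t * x (vertexThree k) = _ := g 3 ⟨0, Nat.one_pos⟩ (by decide) (by decide)
  rw [show (⟨3, ⟨0, Nat.one_pos⟩⟩ : GVertex k) = vertexThree k from rfl,
    neighborSum_vertexThree] at f3
  have ht1 : (0 : ℝ) < 1 + t := by linarith
  have s4 : (1 + t) * labelSum x 4 = k * (1 + x (vertexZero k) + labelSum x 4) := by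
    rw [labelSum, Finset.mul_sum, Finset.sum_congr rfl fun i _ => f4 i]
    simp [l4, labelSum]
    ring
  have s6 : (1 + t) * labelSum x 6 = k * (1 + x (vertexTwo k) + labelSum x 6) := by
    rw [labelSum, Finset.mul_sum, Finset.sum_congr rfl fun i _ => f6 i]
    simp [l6, labelSum]
    ring
  have s5 : t * labelSum x 5 = ((k : ℝ) - 1) * ((k : ℝ) - 2) * (1 + x (vertexOne k)) := by
    rw [labelSum, Finset.mul_sum, Finset.sum_congr rfl fun i _ => f5 i]
    simp [labelCount_five_cast hk]
    ring
  have hk0 : (0 : ℝ) < k := by exact_mod_cast (by omega : 0 < k)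
  have htk : t = k + s := by linarith
  have p0 := hx (vertexZero k)
  have p3 := hx (vertexThree k)
  -- The signs come from positivity of the solution: the clique equation gives 1 + s > 0, then the
  -- equation for q x₀ gives q > 0, and then s > 0.
  have hs1 : 0 < 1 + s := by
    have h4 : 0 ≤ labelSum x 4 := Finset.sum_nonneg fun i _ => (hx _).le
    refine pos_of_mul_pos_left (b := labelSum x 4) ?_ h4
    have : (1 + s) * labelSum x 4 = k * (1 + x (vertexZero k)) := by
      rw [hs]; linear_combination s4
    rw [this]
    positivity
  have e0 : q * x (vertexZero k) = (1 + s) * (1 + b₀ + x (vertexThree k)) + k := by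
    rw [hq]
    rw [htk] at f0 s4
    linear_combination (1 + s) * f0 + s4
  have e2 : q * x (vertexTwo k) = (1 + s) * (1 + x (vertexOne k) + x (vertexThree k)) + k := by
    rw [hq]
    rw [htk] at f2 s6
    linear_combination (1 + s) * f2 + s6
  have hq0 : 0 < q := by
    refine pos_of_mul_pos_left ?_ p0.le
    rw [e0]
    positivity
  refine ⟨?_, fun i => ?_, e0, e2, ?_, ?_⟩
  · rw [hq] at hq0
    exact pos_of_mul_pos_left hq0 (by linarith)
  · refine mul_left_cancel₀ ht1.ne' ?_
    have hs4 : (1 + s) * labelSum x 4 = k * (1 + x (vertexZero k)) := by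
      rw [hs]; linear_combination s4
    rw [htk] at f4 ⊢
    linear_combination (1 + s) * f4 i + hs4
  · rw [f3]; ring
  · rw [hd]
    linear_combination t * f1 + s5

end KatzGraph

/-! ### The bound on ρ', the Katz systems of both graphs, and the violation. -/

section MainTheorem

variable {k : ℕ}

theorem graphSpectralRadius_katzGraph'_le (hk : 54 ≤ k) :
    graphSpectralRadius (katzGraph' k) ≤ (k : ℝ) + 3 / (4 * (k : ℝ)) := by
  have hkR : (54 : ℝ) ≤ k := by exact_mod_cast hk
  have hk0 : (0 : ℝ) < k := by linarith
  obtain ⟨s, hs⟩ : ∃ s : ℝ, s = 3 / (4 * (k : ℝ)) := ⟨_, rfl⟩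
  obtain ⟨t, ht⟩ : ∃ t : ℝ, t = k + s := ⟨_, rfl⟩
  obtain ⟨d, hd⟩ : ∃ d : ℝ, d = t ^ 2 - ((k : ℝ) - 1) * ((k : ℝ) - 2) := ⟨_, rfl⟩
  have hks : k * s = 3 / 4 := by rw [hs]; field_simp
  have hs0 : 0 < s := by rw [hs]; positivity
  have ht0 : 0 < t := by rw [ht]; positivity
  have hd0 : 0 < d := by
    rw [hd, ht]
    nlinarith
  have key := katz_test_vector_inequality hkR hks ht hd
  rw [← hs, ← ht]
  -- Take the value 1 at 0 and 2, which play symmetric roles in G', and solve the eigenvalue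
  -- equations for t at all other labels. Only the inequality at 0 and 2 remains, and it is
  -- `katz_test_vector_inequality`.
  let y : Fin 7 → ℝ := ![1, 2 * t / d, 1, 2 / t, 1 / (1 + s), 2 / d, 1 / (1 + s)]
  have hy : ∀ l, 0 < y l := by
    intro l
    fin_cases l <;> simp only [y] <;> norm_num <;> positivity
  have hsum : ∀ l, labelSum (fun v : GVertex k => y v.1) l = labelCount k l * y l :=
    fun l => labelSum_of_const fun _ => rfl
  have l4 : (labelCount k 4 : ℝ) = k := rfl
  have l6 : (labelCount k 6 : ℝ) = k := rfl
  have l5 := labelCount_five_cast (k := k) (by omega)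
  have y0 : y 0 = 1 := rfl
  have y1 : y 1 = 2 * t / d := rfl
  have y2 : y 2 = 1 := rfl
  have y3 : y 3 = 2 / t := rfl
  have y4 : y 4 = 1 / (1 + s) := rfl
  have y5 : y 5 = 2 / d := rfl
  have y6 : y 6 = 1 / (1 + s) := rfl
  have hclique : 1 + k * (1 / (1 + s)) - 1 / (1 + s) = t * (1 / (1 + s)) := by
    rw [ht]
    field_simp
    ring
  refine graphSpectralRadius_le _ ht0.le (x := fun v => y v.1) (fun v => hy v.1) ?_
  have hne : ∀ (l : Fin 7) (i : Fin (labelCount k l)), l ≠ 0 → l ≠ 1 →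
      neighborSum (katzGraph' k) (fun v => y v.1) ⟨l, i⟩ =
        neighborSum (katzGraph k) (fun v => y v.1) ⟨l, i⟩ := by
    intro l i h0 h1
    rw [neighborSum_katzGraph', if_neg fun h => h0 (congrArg Sigma.fst h),
      if_neg fun h => h1 (congrArg Sigma.fst h), add_zero, add_zero]
  have c0 : neighborSum (katzGraph' k) (fun v => y v.1) (vertexZero k) ≤ t * y 0 := by
    rw [neighborSum_katzGraph', neighborSum_vertexZero, if_pos rfl,
      if_neg vertexOne_ne_vertexZero.symm, hsum, l4]
    change y 3 + k * y 4 + y 1 + 0 ≤ t * y 0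
    rw [y0, y1, y3, y4, mul_one_div]
    linarith
  have c1 : neighborSum (katzGraph' k) (fun v => y v.1) (vertexOne k) ≤ t * y 1 := by
    rw [neighborSum_katzGraph', neighborSum_vertexOne, if_neg vertexOne_ne_vertexZero,
      if_pos rfl, hsum, l5]
    change y 2 + ((k : ℝ) - 1) * ((k : ℝ) - 2) * y 5 + 0 + y 0 ≤ t * y 1
    rw [y0, y1, y2, y5]
    apply le_of_eq
    field_simp
    rw [hd]
    ring
  have c2 : neighborSum (katzGraph' k) (fun v => y v.1) (vertexTwo k) ≤ t * y 2 := by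
    rw [vertexTwo, hne _ _ (by decide) (by decide), ← vertexTwo, neighborSum_vertexTwo, hsum, l6]
    change y 1 + y 3 + k * y 6 ≤ t * y 2
    rw [y1, y2, y3, y6, mul_one_div]
    linarith
  have c3 : neighborSum (katzGraph' k) (fun v => y v.1) (vertexThree k) ≤ t * y 3 := by
    rw [vertexThree, hne _ _ (by decide) (by decide), ← vertexThree, neighborSum_vertexThree]
    change y 0 + y 2 ≤ t * y 3
    rw [y0, y2, y3]
    apply le_of_eq
    field_simp
    norm_num
  rintro ⟨l, i⟩
  change _ ≤ t * y l
  fin_cases l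
  · exact (eq_vertexZero i).symm ▸ c0
  · exact (eq_vertexOne i).symm ▸ c1
  · exact (eq_vertexTwo i).symm ▸ c2
  · exact (eq_vertexThree i).symm ▸ c3
  · change neighborSum _ _ (⟨4, i⟩ : GVertex k) ≤ t * y 4
    rw [hne _ _ (by decide) (by decide), neighborSum_label_four, hsum, l4]
    change y 0 + k * y 4 - y 4 ≤ t * y 4
    rw [y0, y4, hclique]
  · change neighborSum _ _ (⟨5, i⟩ : GVertex k) ≤ t * y 5
    rw [hne _ _ (by decide) (by decide), neighborSum_label_five]
    change y 1 ≤ t * y 5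
    rw [y1, y5, mul_comm 2 t, mul_div_assoc]
  · change neighborSum _ _ (⟨6, i⟩ : GVertex k) ≤ t * y 6
    rw [hne _ _ (by decide) (by decide), neighborSum_label_six, hsum, l6]
    change y 2 + k * y 6 - y 6 ≤ t * y 6
    rw [y2, y6, hclique]

open Classical in
/-- The quotient system for Katz's index on `G_k`, rescaled by `α`. -/
theorem katzIndex_katzGraph_system (hk : 2 ≤ k) {α s q d : ℝ} (hα : 0 < α)
    (h : graphSpectralRadius (katzGraph k) < 1 / α) (hs : s = 1 / α - k)
    (hq : q = s * (k + 1 + s))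
    (hd : d = (1 / α) ^ 2 - ((k : ℝ) - 1) * ((k : ℝ) - 2)) :
    let x := fun v => α * katzIndex α (katzGraph k) v
    0 < s ∧ (∀ i, (1 + s) * x ⟨4, i⟩ = 1 + x (vertexZero k)) ∧
      q * x (vertexZero k) = (1 + s) * (1 + x (vertexThree k)) + k ∧
      q * x (vertexTwo k) = (1 + s) * (1 + x (vertexOne k) + x (vertexThree k)) + k ∧
      1 / α * x (vertexThree k) = 1 + x (vertexZero k) + x (vertexTwo k) ∧
      d * x (vertexOne k) = 1 / α * (1 + x (vertexTwo k)) + ((k : ℝ) - 1) * ((k : ℝ) - 2) := by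
  intro x
  have hx : ∀ v, 0 < x v := fun v =>
    mul_pos hα (zero_lt_one.trans_le (one_le_katzIndex _ hα h v))
  have := katz_quotient_system hk (one_div_pos.mpr hα) hx le_rfl (b₁ := 0) (fun v => ?_) hs hq hd
  · simpa only [add_zero] using this
  · rw [neighborSum_mul_left]
    simp only [x]
    rw [← mul_assoc, one_div_mul_cancel hα.ne', one_mul, katzIndex_eq _ hα h v]
    simp

open Classical in
/-- The quotient system for Katz's index on `G'_k`, rescaled by `α`. -/
theorem katzIndex_katzGraph'_system (hk : 2 ≤ k) {α s q d : ℝ} (hα : 0 < α)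
    (h : graphSpectralRadius (katzGraph' k) < 1 / α) (hs : s = 1 / α - k)
    (hq : q = s * (k + 1 + s))
    (hd : d = (1 / α) ^ 2 - ((k : ℝ) - 1) * ((k : ℝ) - 2)) :
    let x := fun v => α * katzIndex α (katzGraph' k) v
    0 < s ∧ (∀ i, (1 + s) * x ⟨4, i⟩ = 1 + x (vertexZero k)) ∧
      q * x (vertexZero k) = (1 + s) * (1 + x (vertexOne k) + x (vertexThree k)) + k ∧
      d * x (vertexOne k) =
        1 / α * (1 + 2 * x (vertexZero k)) + ((k : ℝ) - 1) * ((k : ℝ) - 2) := by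
  intro x
  have hx : ∀ v, 0 < x v := fun v =>
    mul_pos hα (zero_lt_one.trans_le (one_le_katzIndex _ hα h v))
  have := katz_quotient_system hk (one_div_pos.mpr hα) hx
    (hx (vertexOne k)).le (b₁ := x (vertexZero k)) (fun v => ?_) hs hq hd
  · obtain ⟨h1, h2, h3, h4, -, h6⟩ := this
    have hk0 : (0 : ℝ) < k := by exact_mod_cast (by omega : 0 < k)
    have hq0 : 0 < q := by rw [hq]; positivity
    have h02 : x (vertexTwo k) = x (vertexZero k) :=
      mul_left_cancel₀ hq0.ne' (h4.trans h3.symm)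
    refine ⟨h1, h2, h3, ?_⟩
    rw [h6, h02]
    ring
  · have e := neighborSum_mul_left (katzGraph' k) α (katzIndex α (katzGraph' k)) v
    rw [neighborSum_katzGraph'] at e
    change 1 / α * (α * katzIndex α (katzGraph' k) v) = _
    rw [← mul_assoc, one_div_mul_cancel hα.ne', one_mul, katzIndex_eq _ hα h v, ← e]
    ring

/-- For every t > ρ the Katz vector at 1/t is positive, and the quotient system then forces s = t -
k > 0. The main use is ρ > 0, so that the reciprocals are not the default value 1/0 = 0. -/
theorem le_graphSpectralRadius_katzGraph (hk : 2 ≤ k) :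
    (k : ℝ) ≤ graphSpectralRadius (katzGraph k) := by
  refine le_of_forall_gt_imp_ge_of_dense fun t ht => ?_
  have ht0 : 0 < t := (graphSpectralRadius_nonneg _).trans_lt ht
  have := (katzIndex_katzGraph_system hk (inv_pos.mpr ht0) (by simpa using ht) rfl rfl rfl).1
  rw [one_div, inv_inv] at this
  linarith

theorem katzGraph_le_katzGraph' : katzGraph k ≤ katzGraph' k := le_sup_left

theorem topRankViolation_katzGraph (hk : 54 ≤ k) {α : ℝ} (hα : 0 < α)
    (hρ : graphSpectralRadius (katzGraph' k) < 1 / α)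
    (hα' : 1 / α ≤ (k : ℝ) + 7501 / (10000 * (k : ℝ))) :
    TopRankViolation (katzIndex α) (katzGraph k) (vertexOne k) (vertexZero k) := by
  have hkR : (54 : ℝ) ≤ k := by exact_mod_cast hk
  have hk0 : (0 : ℝ) < k := by linarith
  have hk2 : 2 ≤ k := by omega
  have hρ₁ := (graphSpectralRadius_mono (katzGraph_le_katzGraph' (k := k))).trans_lt hρ
  have hpos := fun v => mul_pos hα (zero_lt_one.trans_le (one_le_katzIndex _ hα hρ₁ v))
  have hpos' := fun v => mul_pos hα (zero_lt_one.trans_le (one_le_katzIndex _ hα hρ v))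
  obtain ⟨s, hs⟩ : ∃ s : ℝ, s = 1 / α - k := ⟨_, rfl⟩
  have ht : 1 / α = k + s := by linarith
  have hks : k * s ≤ 7501 / 10000 := by
    calc k * s ≤ k * (7501 / (10000 * (k : ℝ))) := by gcongr; linarith
      _ = 7501 / 10000 := by field_simp
  obtain ⟨hs0, e4, e0, e2, e3, e1⟩ := katzIndex_katzGraph_system hk2 hα hρ₁ hs rfl rfl
  obtain ⟨-, e4', e0', e1'⟩ := katzIndex_katzGraph'_system hk2 hα hρ hs rfl rfl
  have hlt := katz_score_zero_lt_one hkR hs0 hks ht rfl rfl (hpos _) (hpos _) e0 e2 e3 e1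
  have hle := katz_score_one_le_four hkR hs0 hks ht rfl rfl (hpos' _) (hpos' _) (hpos' _) e0' e1'
  have hs1 : 0 < 1 + s := by linarith
  let z : GVertex k := ⟨4, ⟨0, show 0 < k by omega⟩⟩
  have h4 : α * katzIndex α (katzGraph k) z < α * katzIndex α (katzGraph k) (vertexZero k) := by
    refine lt_of_mul_lt_mul_left ?_ hs1.le
    -- Since (1 + s)x₄ = 1 + x₀, the claim x₄ < x₀ reduces to 1 < s x₀. Multiplied by k + 1 + s it
    -- reads k + 1 + s < q x₀ = (1 + s)(1 + x₃) + k, which holds because x₃ > 0.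
    rw [e4, add_mul, one_mul, add_comm, add_lt_add_iff_left]
    refine lt_of_mul_lt_mul_left (a := k + 1 + s) ?_ (by linarith)
    nlinarith [hpos (vertexThree k)]
  have h4' : α * katzIndex α (katzGraph' k) (vertexOne k) ≤ α * katzIndex α (katzGraph' k) z := by
    refine le_of_mul_le_mul_left ?_ hs1
    rw [e4']
    exact hle
  refine ⟨vertexOne_ne_vertexZero, not_adj_vertexOne_vertexZero,
    lt_of_mul_lt_mul_left hlt hα.le, z, ?_, ?_, fun h => ?_⟩
  · exact fun h => absurd (congrArg Sigma.fst h) (by decide : (4 : Fin 7) ≠ 1)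
  · exact fun h => absurd (congrArg Sigma.fst h) (by decide : (4 : Fin 7) ≠ 0)
  · have := h.1 (lt_of_mul_lt_mul_left (h4.trans hlt) hα.le)
    exact (mul_lt_mul_of_pos_left this hα).not_ge h4'

theorem TopRankViolation.not_rankMonotoneOn {V : Type*} {c : SimpleGraph V → V → ℝ}
    {G : SimpleGraph V} {x y : V} (h : TopRankViolation c G x y) : ¬ RankMonotoneOn c G := by
  obtain ⟨hne, hadj, -, z, hzx, hzy, hz⟩ := h
  exact fun hm => hz (hm x y hne hadj z hzx hzy).1

end MainTheorem

theorem mainTheorem5 (k : ℕ) (hk : 54 ≤ k) :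
    ∃ ν : ℝ, 0 ≤ ν ∧ ν < 1 / ((k : ℝ) + 3 / (4 * (k : ℝ))) ∧
      ν < 1 / graphSpectralRadius (katzGraph' k) ∧
      ∀ α : ℝ, ν < α → α < 1 / graphSpectralRadius (katzGraph' k) →
        α < 1 / graphSpectralRadius (katzGraph k) ∧
        ¬ RankMonotoneOn (katzIndex α) (katzGraph k) ∧
        TopRankViolation (katzIndex α) (katzGraph k) (vertexOne k) (vertexZero k) := by
  have hk0 : (0 : ℝ) < k := by exact_mod_cast (by omega : 0 < k)
  have hle := graphSpectralRadius_katzGraph'_le hk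
  have hρ : 0 < graphSpectralRadius (katzGraph k) :=
    hk0.trans_le (le_graphSpectralRadius_katzGraph (by omega))
  have hmono := graphSpectralRadius_mono (katzGraph_le_katzGraph' (k := k))
  have hρ' := hρ.trans_le hmono
  have hlt : (k : ℝ) + 3 / (4 * (k : ℝ)) < k + 7501 / (10000 * (k : ℝ)) := by
    have h1 : 3 / (4 * (k : ℝ)) = 3 / 4 * (1 / k) := by field_simp
    have h2 : 7501 / (10000 * (k : ℝ)) = 7501 / 10000 * (1 / k) := by field_simp
    have h3 : 0 < 1 / (k : ℝ) := by positivity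
    rw [h1, h2]
    linarith
  have hT : 0 < (k : ℝ) + 7501 / (10000 * (k : ℝ)) := by positivity
  -- Because 7501/10000 > 3/4, this ν lies strictly below both 1/(k + 3/(4k)) and 1/ρ', and α > ν
  -- gives exactly ks < 7501/10000.
  refine ⟨1 / (k + 7501 / (10000 * (k : ℝ))), by positivity,
    one_div_lt_one_div_of_lt (by positivity) hlt,
    one_div_lt_one_div_of_lt hρ' (hle.trans_lt hlt), fun α h1 h2 => ?_⟩
  have hα : 0 < α := (one_div_pos.mpr hT).trans h1
  have hv := topRankViolation_katzGraph hk hα ((lt_one_div hα hρ').mp h2)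
    ((one_div_lt hT hα).mp h1).le
  exact ⟨h2.trans_le (one_div_le_one_div_of_le hρ hmono), hv.not_rankMonotoneOn, hv⟩
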